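/- There exists a nonempty finite $T_0$-space $X$ with $\operatorname{tc}(X)<\operatorname{cat}(X\times X)$. More precisely, for every $n\ge 5$ the Khalimsky circle $\mathbb S^1_n$ satisfies $$\operatorname{tc}(\mathbb S^1_n)=1\quad\text{and}\quad \operatorname{cat}(\mathbb S^1_n\times\mathbb S^1_n)=2,$$ so that $\operatorname{tc}(\mathbb S^1_n)<\operatorname{cat}(\mathbb S^1_n\times\mathbb S^1_n)$. Here $\mathbb S^1_n=\{a_0,\dots,a_{n-1},b_0,\dots,b_{n-1}\}$ carries the topology with open sub-basis $\{a_i,b_i,a_{i+1}\}$, $i\in\mathbb Z/n$. For a space $X$, let $PX$ be the space of continuous maps $[0,1]\to X$ with the compact-open topology. Then $\operatorname{tc}(X)$ is the least integer $m\ge 0$ such that $X\times X$ is covered by $m+1$ open subsets, over each of which the map $PX\to X\times X$, $\gamma\mapsto(\gamma(0),\gamma(1))$, has a continuous section. For a space $Y$ with base point $*$, $\operatorname{cat}(Y)$ is the least integer $m\ge 0$ such that $Y$ is covered by $m+1$ open subsets, over each of which the map $\{\gamma\in PY\mid \gamma(0)=*\}\to Y$, $\gamma\mapsto\gamma(1)$,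 has a continuous section. (Either number is $\infty$ if there is no such $m$.) The statements about $\operatorname{cat}$ hold for every choice of base point. -/

import Mathlib

open scoped unitInterval

/-- A map `p : E → B` has a continuous section over the subset `U` of `B`. -/
def HasSectionOver {E B : Type*} [TopologicalSpace E] [TopologicalSpace B]
    (p : E → B) (U : Set B) : Prop :=
  ∃ s : C(U, E), ∀ u : U, p (s u) = (u : B)

/-- The least `m ≥ 0` such that `B` is covered by `m + 1` open subsets each of which carries a
continuous section of `p : E → B`; it is `⊤` if there is no such `m`. -/
noncomputable def sectionalCategory {E B : Type*} [TopologicalSpace E] [TopologicalSpace B]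
    (p : E → B) : ℕ∞ :=
  sInf {k : ℕ∞ | ∃ m : ℕ, k = (m : ℕ∞) ∧ ∃ U : Fin (m + 1) → Set B,
    (∀ i, IsOpen (U i)) ∧ (⋃ i, U i) = Set.univ ∧ ∀ i, HasSectionOver p (U i)}

/-- The projection `γ ↦ (γ 0, γ 1)` from the path space `PX` (with the compact-open topology). -/
def pathProjection (X : Type*) [TopologicalSpace X] : C(I, X) → X × X :=
  fun γ => (γ 0, γ 1)

/-- The projection `γ ↦ γ 1` from the space of paths of `X` that start at `x₀`. -/
def basedPathProjection (X : Type*) [TopologicalSpace X] (x₀ : X) :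
    {γ : C(I, X) // γ 0 = x₀} → X :=
  fun γ => γ.1 1

/-- The (reduced) topological complexity of `X`. -/
noncomputable def tc (X : Type*) [TopologicalSpace X] : ℕ∞ :=
  sectionalCategory (pathProjection X)

/-- The (reduced) Lusternik–Schnirelmann category of `X` with base point `x₀`. -/
noncomputable def lsCat (X : Type*) [TopologicalSpace X] (x₀ : X) : ℕ∞ :=
  sectionalCategory (basedPathProjection X x₀)

/-- The underlying set `{a_i, b_i | i ∈ ℤ/n}` of the Khalimsky circle with `2n` points. -/
inductive KhalimskyCircle (n : ℕ) : Type
  | a (i : ZMod n) : KhalimskyCircle n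
  | b (i : ZMod n) : KhalimskyCircle n

/-- The topology with open sub-basis `{a_i, b_i, a_{i+1}}`, `i ∈ ℤ/n`. -/
instance KhalimskyCircle.instTopologicalSpace (n : ℕ) : TopologicalSpace (KhalimskyCircle n) :=
  TopologicalSpace.generateFrom (Set.range fun i : ZMod n =>
    {KhalimskyCircle.a i, KhalimskyCircle.b i, KhalimskyCircle.a (i + 1)})

/-! ### The specialization order of the Khalimsky line -/

/-! Pointwise comparable maps are homotopic, and the circle is the Khalimsky line modulo `2 * n`, on
which `max`, `min` and even translations preserve `KLe`. Homotopies on open sets of the torus are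
thus written as chains of integer functions on down-closed sets of the plane
(`ChartHomotopic.of_chain`).

Upper bounds: three squares, each missing one odd point in both coordinates, cover the torus and
contract by truncation. For tc, two annuli cover it. Near the diagonal both projections deform to
the maximum of the coordinates. On the other annulus the lifts satisfy `y ≤ x`, and `y` is deformed
to `x` by clamping to `[y, x]` a degree one map to the circle that is rotated upwards. A degree one
map can be rotated because the annulus has a core circle of length `4 * n - 8`, at least `2 * n + 2`
when `n ≥ 5`.

Lower bounds: the line covers the circle, so null-homotopic maps lift, and lift minus coordinate,
divided by `2 * n`, is locally constant (`winding_eq`). On the whole circle this is absurd, so tc is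
at least 1. If two open sets with sections covered the torus, they would give cochains whose cup
product vanishes on each unit square but sums to 1 over a period (`exists_square_of_winding`). -/

/-- The specialization relation `k ⤳ l` of the Khalimsky line: even points are open. -/
def KLe (k l : ℤ) : Prop := k = l ∨ (k % 2 = 0 ∧ (k = l + 1 ∨ l = k + 1))

theorem KLe.refl (k : ℤ) : KLe k k := Or.inl rfl

theorem KLe.trans {k l m : ℤ} (h : KLe k l) (h' : KLe l m) : KLe k m := by
  unfold KLe at *; omega

theorem KLe.max {k l k' l' : ℤ} (h : KLe k k') (h' : KLe l l') :
    KLe (max k l) (max k' l') := by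
  unfold KLe at *; omega

theorem KLe.min {k l k' l' : ℤ} (h : KLe k k') (h' : KLe l l') :
    KLe (min k l) (min k' l') := by
  unfold KLe at *; omega

theorem KLe.add_even {k l c : ℤ} (hc : c % 2 = 0) (h : KLe k l) : KLe (k + c) (l + c) := by
  unfold KLe at *; omega

theorem KLe.succ (k : ℤ) : KLe k (k + 1) ∨ KLe (k + 1) k := by
  unfold KLe; omega

/-! ### The circle as a quotient of the Khalimsky line -/

namespace KhalimskyCircle

variable {n : ℕ}

/-- The covering projection from the Khalimsky line onto the Khalimsky circle. -/
def proj (n : ℕ) (k : ℤ) : KhalimskyCircle n :=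
  if k % 2 = 0 then a ((k / 2 : ℤ) : ZMod n) else b ((k / 2 : ℤ) : ZMod n)

theorem proj_even (n : ℕ) (i : ℤ) : proj n (2 * i) = a (i : ZMod n) := by
  have h : 2 * i / 2 = i := by omega
  simp [proj, h]

theorem proj_odd (n : ℕ) (i : ℤ) : proj n (2 * i + 1) = b (i : ZMod n) := by
  have h : (2 * i + 1) / 2 = i := by omega
  have h' : ¬ (2 * i + 1) % 2 = 0 := by omega
  rw [proj, if_neg h', h]

theorem proj_surjective (n : ℕ) : Function.Surjective (proj n) := by
  rintro (i | i)
  · obtain ⟨k, rfl⟩ := ZMod.intCast_surjective i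
    exact ⟨2 * k, proj_even n k⟩
  · obtain ⟨k, rfl⟩ := ZMod.intCast_surjective i
    exact ⟨2 * k + 1, proj_odd n k⟩

theorem proj_eq_iff {k l : ℤ} : proj n k = proj n l ↔ ∃ m : ℤ, l = k + 2 * n * m := by
  constructor
  · intro h
    unfold proj at h
    split_ifs at h with h1 h2 h2
    all_goals
      simp only [a.injEq, b.injEq, ZMod.intCast_eq_intCast_iff_dvd_sub] at h
      obtain ⟨m, hm⟩ := h
      refine ⟨m, ?_⟩
      have e : 2 * (n : ℤ) * m = 2 * (l / 2 - k / 2) := by rw [hm]; ring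
      omega
  · rintro ⟨m, rfl⟩
    have h1 : (k + 2 * n * m) % 2 = k % 2 := by
      rw [mul_assoc]; omega
    have h2 : (k + 2 * n * m) / 2 = k / 2 + n * m := by
      rw [mul_assoc]; omega
    simp [proj, h1, h2]

theorem proj_add_period (k m : ℤ) : proj n (k + 2 * n * m) = proj n k :=
  (proj_eq_iff.2 ⟨m, rfl⟩).symm

theorem proj_add (k : ℤ) : proj n (k + 2 * n) = proj n k := by
  simpa using proj_add_period (n := n) k 1

theorem eq_of_proj_eq_of_lt {k l : ℤ} (h : proj n k = proj n l)
    (h1 : l < k + 4 * n) (h2 : k < l + 4 * n) :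
    l = k ∨ l = k + 2 * n ∨ k = l + 2 * n := by
  obtain ⟨m, hm⟩ := proj_eq_iff.1 h
  rcases lt_trichotomy m 0 with h0 | rfl | h0
  · rcases (show m = -1 ∨ m ≤ -2 by omega) with rfl | h3
    · right; right; linarith
    · nlinarith
  · left; simpa using hm
  · rcases (show m = 1 ∨ 2 ≤ m by omega) with rfl | h3
    · right; left; linarith
    · nlinarith

theorem exists_proj_eq [NeZero n] (x : KhalimskyCircle n) (c : ℤ) :
    ∃ k, c ≤ k ∧ k < c + 2 * n ∧ proj n k = x := by
  obtain ⟨k, rfl⟩ := proj_surjective n x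
  have hn : (0 : ℤ) < 2 * n := by have := NeZero.pos n; omega
  refine ⟨c + (k - c) % (2 * n), ?_, ?_, ?_⟩
  · have := Int.emod_nonneg (k - c) hn.ne'; omega
  · have := Int.emod_lt_of_pos (k - c) hn; omega
  · refine proj_eq_iff.2 ⟨(k - c) / (2 * n), ?_⟩
    have := Int.emod_add_mul_ediv (k - c) (2 * n)
    linarith

instance [NeZero n] : Finite (KhalimskyCircle n) := by
  refine Finite.of_surjective (fun k : Set.Ico (0 : ℤ) (0 + 2 * n) => proj n k) fun x => ?_
  obtain ⟨k, h1, h2, h3⟩ := exists_proj_eq x 0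
  exact ⟨⟨k, h1, h2⟩, h3⟩

instance : Nonempty (KhalimskyCircle n) := ⟨a 0⟩

theorem isOpen_star (i : ZMod n) : IsOpen ({a i, b i, a (i + 1)} : Set (KhalimskyCircle n)) :=
  TopologicalSpace.isOpen_generateFrom_of_mem ⟨i, rfl⟩

theorem specializes_of_forall_star {x y : KhalimskyCircle n}
    (h : ∀ i : ZMod n, y ∈ ({a i, b i, a (i + 1)} : Set (KhalimskyCircle n)) →
      x ∈ ({a i, b i, a (i + 1)} : Set (KhalimskyCircle n))) : x ⤳ y := by
  have : nhds y = _ := TopologicalSpace.nhds_generateFrom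
  rw [Specializes, this]
  refine le_iInf₂ fun s hs => ?_
  obtain ⟨h1, i, rfl⟩ := hs
  exact Filter.le_principal_iff.2 ((isOpen_star i).mem_nhds (h i h1))

theorem specializes_proj {k l : ℤ} (h : KLe k l) : proj n k ⤳ proj n l := by
  rcases h with rfl | ⟨h1, h2⟩
  · exact specializes_rfl
  · obtain ⟨i, rfl⟩ : ∃ i, l = 2 * i + 1 := ⟨l / 2, by omega⟩
    rw [proj_odd]
    refine specializes_of_forall_star fun j hj => ?_
    simp only [Set.mem_insert_iff, reduceCtorEq, b.injEq, Set.mem_singleton_iff, false_or,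
      or_false] at hj
    subst hj
    rcases (show k = 2 * (i + 1) ∨ k = 2 * i by omega) with rfl | rfl
    · rw [proj_even]; simp
    · rw [proj_even]; simp

/-- Lifting of specializations; through it down-closed sets and order-preserving functions pass from
the line to the circle. -/
theorem exists_of_specializes_proj (hn : 3 ≤ n) {x : KhalimskyCircle n} {l : ℤ}
    (h : x ⤳ proj n l) : ∃ k, KLe k l ∧ proj n k = x := by
  have key : ∀ i : ZMod n, proj n l ∈ ({a i, b i, a (i + 1)} : Set (KhalimskyCircle n)) →
      x ∈ ({a i, b i, a (i + 1)} : Set (KhalimskyCircle n)) := fun i hi =>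
    h.mem_open (isOpen_star i) hi
  rcases Int.even_or_odd' l with ⟨i, rfl | rfl⟩
  · have h1 := key i (by rw [proj_even]; simp)
    -- The two stars containing `a i` meet only in `a i`, because `1` and `2` are nonzero modulo
    -- `n`.
    have h2 := key (i - 1 : ZMod n) (by rw [proj_even]; simp)
    refine ⟨2 * i, KLe.refl _, ?_⟩
    rw [proj_even]
    have hone : (1 : ZMod n) ≠ 0 := by
      have : Fact (1 < n) := ⟨by omega⟩
      exact one_ne_zero
    have htwo : (2 : ZMod n) ≠ 0 := by
      intro h0
      have : ((2 : ℕ) : ZMod n) = 0 := by exact_mod_cast h0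
      rw [ZMod.natCast_eq_zero_iff] at this
      exact absurd (Nat.le_of_dvd (by norm_num) this) (by omega)
    simp only [Set.mem_insert_iff, Set.mem_singleton_iff, sub_add_cancel] at h1 h2
    rcases h1 with rfl | rfl | rfl
    · rfl
    · simp only [reduceCtorEq, b.injEq, false_or, or_false] at h2
      exact absurd (by linear_combination h2) hone
    · simp only [reduceCtorEq, a.injEq, false_or] at h2
      rcases h2 with h2 | h2
      · exact absurd (by linear_combination h2) htwo
      · exact absurd (by linear_combination h2) hone
  · have h1 := key i (by rw [proj_odd]; simp)
    simp only [Set.mem_insert_iff, Set.mem_singleton_iff] at h1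
    rcases h1 with rfl | rfl | rfl
    · exact ⟨2 * i, by unfold KLe; omega, proj_even n i⟩
    · exact ⟨2 * i + 1, KLe.refl _, proj_odd n i⟩
    · exact ⟨2 * (i + 1), by unfold KLe; omega, by rw [proj_even]; simp⟩

theorem t0Space (hn : 3 ≤ n) : T0Space (KhalimskyCircle n) := by
  refine ⟨fun x y h => ?_⟩
  obtain ⟨k, rfl⟩ := proj_surjective n x
  obtain ⟨l, h1, rfl⟩ := exists_of_specializes_proj hn h.specializes'
  obtain ⟨m, h2, h3⟩ := exists_of_specializes_proj hn h.specializes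
  rcases h1 with rfl | ⟨h1, h1'⟩
  · rfl
  · rcases h2 with rfl | ⟨h2, h2'⟩
    · exact h3.symm
    · obtain ⟨r, hr⟩ := proj_eq_iff.1 h3
      rw [mul_assoc] at hr
      omega

instance : PathConnectedSpace (KhalimskyCircle n) := by
  refine ⟨inferInstance, ?_⟩
  have key : ∀ k : ℤ, Joined (proj n k) (proj n (k + 1)) := fun k => by
    rcases KLe.succ k with h | h
    · exact ((specializes_proj h).joinedIn (Set.mem_univ _) (Set.mem_univ _)).joined
    · exact ((specializes_proj h).joinedIn (Set.mem_univ _) (Set.mem_univ _)).joined.symm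
  have key' : ∀ k : ℤ, Joined (proj n 0) (proj n k) := fun k => by
    induction k using Int.induction_on with
    | zero => exact Joined.refl _
    | succ i ih => exact ih.trans (key i)
    | pred i ih =>
      have := key (-(i : ℤ) - 1)
      rw [sub_add_cancel] at this
      exact ih.trans this.symm
  intro x y
  obtain ⟨k, rfl⟩ := proj_surjective n x
  obtain ⟨l, rfl⟩ := proj_surjective n y
  exact (key' k).symm.trans (key' l)

end KhalimskyCircle

/-! ### Homotopies and sections -/

/-- Maps that are pointwise comparable in the specialization order are homotopic. -/
theorem ContinuousMap.Homotopic.of_specializes {A B : Type*} [TopologicalSpace A]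
    [TopologicalSpace B] {f g : C(A, B)} (h : ∀ x, f x ⤳ g x) : f.Homotopic g := by
  classical
  -- The homotopy rests at `f` and jumps to `g` at time 1; this is continuous since each open set
  -- pulls back along `g` into its pullback along `f`.
  refine ⟨⟨⟨fun q : I × A => if q.1 = 1 then g q.2 else f q.2, ?_⟩, fun x => ?_, fun x => ?_⟩⟩
  · refine continuous_def.2 fun O hO => ?_
    have : (fun q : I × A => if q.1 = 1 then g q.2 else f q.2) ⁻¹' O =
        ({1}ᶜ ×ˢ (f ⁻¹' O)) ∪ (Set.univ ×ˢ (g ⁻¹' O)) := by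
      ext ⟨t, x⟩
      by_cases ht : t = 1
      · simp [ht]
      · simpa [ht] using fun hx => (h x).mem_open hO hx
    rw [this]
    exact (isOpen_compl_singleton.prod (hO.preimage f.continuous)).union
      (isOpen_univ.prod (hO.preimage g.continuous))
  · simp
  · simp

/-- The inclusion of a subset as a continuous map. -/
def inclusionMap {B : Type*} [TopologicalSpace B] (U : Set B) : C(U, B) :=
  ⟨Subtype.val, continuous_subtype_val⟩

/-- The first coordinate on a subset of a product. -/
def fstOn {B C : Type*} [TopologicalSpace B] [TopologicalSpace C] (U : Set (B × C)) : C(U, B) :=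
  ⟨fun u => u.1.1, continuous_fst.comp continuous_subtype_val⟩

/-- The second coordinate on a subset of a product. -/
def sndOn {B C : Type*} [TopologicalSpace B] [TopologicalSpace C] (U : Set (B × C)) : C(U, C) :=
  ⟨fun u => u.1.2, continuous_snd.comp continuous_subtype_val⟩

theorem hasSectionOver_pathProjection {X : Type*} [TopologicalSpace X] {U : Set (X × X)}
    (h : (fstOn U).Homotopic (sndOn U)) : HasSectionOver (pathProjection X) U := by
  obtain ⟨H⟩ := h
  refine ⟨(H.toContinuousMap.comp ContinuousMap.prodSwap).curry, fun u => ?_⟩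
  ext
  · exact H.map_zero_left u
  · exact H.map_one_left u

theorem hasSectionOver_basedPathProjection {Y : Type*} [TopologicalSpace Y] {y : Y} {U : Set Y}
    (h : (ContinuousMap.const U y).Homotopic (inclusionMap U)) :
    HasSectionOver (basedPathProjection Y y) U := by
  obtain ⟨H⟩ := h
  have hc := (H.toContinuousMap.comp ContinuousMap.prodSwap).curry.continuous
  exact ⟨⟨fun u => ⟨(H.toContinuousMap.comp ContinuousMap.prodSwap).curry u, H.map_zero_left u⟩,
    hc.subtype_mk _⟩, fun u => H.map_one_left u⟩

/-! ### Bounding the sectional category by covers -/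

theorem sectionalCategory_le {E B : Type*} [TopologicalSpace E] [TopologicalSpace B]
    {p : E → B} {m : ℕ} (U : Fin (m + 1) → Set B) (hU : ∀ i, IsOpen (U i))
    (hcov : (⋃ i, U i) = Set.univ) (hs : ∀ i, HasSectionOver p (U i)) :
    sectionalCategory p ≤ m :=
  sInf_le ⟨m, rfl, U, hU, hcov, hs⟩

theorem le_sectionalCategory {E B : Type*} [TopologicalSpace E] [TopologicalSpace B]
    {p : E → B} {m : ℕ}
    (h : ¬ ∃ U : Fin m → Set B, (∀ i, IsOpen (U i)) ∧ (⋃ i, U i) = Set.univ ∧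
      ∀ i, HasSectionOver p (U i)) :
    (m : ℕ∞) ≤ sectionalCategory p := by
  refine le_sInf ?_
  rintro _ ⟨k, rfl, U, hU, hcov, hs⟩
  rw [Nat.cast_le]
  by_contra! hk
  -- A cover by `k + 1 ≤ m` sets is padded to `m` sets by repeating it cyclically.
  refine h ⟨fun i => U (Fin.ofNat (k + 1) i), fun i => hU _, ?_, fun i => hs _⟩
  refine Set.eq_univ_of_forall fun x => ?_
  obtain ⟨i, hi⟩ := Set.mem_iUnion.1 (hcov.symm ▸ Set.mem_univ x : x ∈ ⋃ i, U i)
  refine Set.mem_iUnion.2 ⟨⟨i, by omega⟩, ?_⟩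
  simpa [Fin.ofNat, Nat.mod_eq_of_lt i.2] using hi

namespace KhalimskyCircle

variable {n : ℕ}

/-! ### Maps defined in a chart -/

/-- The covering projection of the Khalimsky plane onto the product of two circles. -/
def projProd (n : ℕ) (w : ℤ × ℤ) : KhalimskyCircle n × KhalimskyCircle n :=
  (proj n w.1, proj n w.2)

/-- Open subsets of the Khalimsky plane. -/
def IsChart (W : Set (ℤ × ℤ)) : Prop :=
  ∀ ⦃x y x' y' : ℤ⦄, KLe x x' → KLe y y' → (x', y') ∈ W → (x, y) ∈ W

theorem specializes_prod_iff {X Y : Type*} [TopologicalSpace X] [TopologicalSpace Y]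
    {a b : X × Y} : a ⤳ b ↔ a.1 ⤳ b.1 ∧ a.2 ⤳ b.2 :=
  ⟨fun h => ⟨h.map continuous_fst, h.map continuous_snd⟩, fun h => h.1.prod h.2⟩

theorem exists_of_specializes_projProd (hn : 3 ≤ n) {W : Set (ℤ × ℤ)} (hW : IsChart W)
    {u : KhalimskyCircle n × KhalimskyCircle n} {w : ℤ × ℤ} (hw : w ∈ W)
    (h : u ⤳ projProd n w) :
    ∃ v ∈ W, KLe v.1 w.1 ∧ KLe v.2 w.2 ∧ projProd n v = u := by
  obtain ⟨h1, h2⟩ := specializes_prod_iff.1 h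
  obtain ⟨k, hk, e1⟩ := exists_of_specializes_proj hn h1
  obtain ⟨l, hl, e2⟩ := exists_of_specializes_proj hn h2
  exact ⟨(k, l), hW hk hl hw, hk, hl, Prod.ext e1 e2⟩

theorem isOpen_image_projProd [NeZero n] (hn : 3 ≤ n) {W : Set (ℤ × ℤ)} (hW : IsChart W) :
    IsOpen (projProd n '' W) := by
  rw [isOpen_iff_forall_specializes]
  rintro u _ h ⟨w, hw, rfl⟩
  obtain ⟨v, hv, -, -, e⟩ := exists_of_specializes_projProd hn hW hw h
  exact ⟨v, hv, e⟩

/-- The function `F` on the chart `W` represents the map `f` on the image of `W`. -/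
def Represents (n : ℕ) (W : Set (ℤ × ℤ)) (F : ℤ × ℤ → ℤ)
    (f : C(projProd n '' W, KhalimskyCircle n)) : Prop :=
  ∀ w (hw : w ∈ W), f ⟨projProd n w, w, hw, rfl⟩ = proj n (F w)

/-- The function `F` on the chart `W` descends to a continuous map on the image of `W`. -/
structure Descends (n : ℕ) (W : Set (ℤ × ℤ)) (F : ℤ × ℤ → ℤ) : Prop where
  mono : ∀ v ∈ W, ∀ w ∈ W, KLe v.1 w.1 → KLe v.2 w.2 → KLe (F v) (F w)
  compat : ∀ v ∈ W, ∀ w ∈ W, proj n v.1 = proj n w.1 → proj n v.2 = proj n w.2 →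
    proj n (F v) = proj n (F w)

theorem Represents.unique {W : Set (ℤ × ℤ)} {F : ℤ × ℤ → ℤ}
    {f g : C(projProd n '' W, KhalimskyCircle n)} (hf : Represents n W F f)
    (hg : Represents n W F g) : f = g := by
  ext ⟨_, w, hw, rfl⟩
  exact (hf w hw).trans (hg w hw).symm

/-- By `compat` the choice of lifts is irrelevant, and on a finite space continuity only requires
that specialization be preserved, which is `mono`. -/
theorem Descends.exists_represents [NeZero n] (hn : 3 ≤ n) {W : Set (ℤ × ℤ)} (hW : IsChart W)
    {F : ℤ × ℤ → ℤ} (hF : Descends n W F) : ∃ f, Represents n W F f := by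
  choose r hr e using fun u : projProd n '' W => u.2
  have key : ∀ w ∈ W, ∀ u : projProd n '' W, projProd n w = u →
      proj n (F (r u)) = proj n (F w) := fun w hw u hu =>
    hF.compat _ (hr u) _ hw (congrArg Prod.fst ((e u).trans hu.symm))
      (congrArg Prod.snd ((e u).trans hu.symm))
  refine ⟨⟨fun u => proj n (F (r u)), ?_⟩, fun w hw => key w hw _ rfl⟩
  refine continuous_def.2 fun O hO => isOpen_iff_forall_specializes.2 fun u v huv hv => ?_
  have h1 : (u : KhalimskyCircle n × KhalimskyCircle n) ⤳ projProd n (r v) := by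
    rw [e v]; exact huv.map continuous_subtype_val
  obtain ⟨w, hw, hw1, hw2, hw3⟩ := exists_of_specializes_projProd hn hW (hr v) h1
  have h2 := specializes_proj (n := n) (hF.mono w hw _ (hr v) hw1 hw2)
  rw [← key w hw u hw3] at h2
  exact h2.mem_open hO hv

/-- Two functions on a chart represent homotopic maps. -/
def ChartHomotopic (n : ℕ) (W : Set (ℤ × ℤ)) (F G : ℤ × ℤ → ℤ) : Prop :=
  ∃ f g, Represents n W F f ∧ Represents n W G g ∧ f.Homotopic g

theorem ChartHomotopic.symm {W : Set (ℤ × ℤ)} {F G : ℤ × ℤ → ℤ}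
    (h : ChartHomotopic n W F G) : ChartHomotopic n W G F := by
  obtain ⟨f, g, hf, hg, h⟩ := h
  exact ⟨g, f, hg, hf, h.symm⟩

theorem ChartHomotopic.trans {W : Set (ℤ × ℤ)} {F G H : ℤ × ℤ → ℤ}
    (h : ChartHomotopic n W F G) (h' : ChartHomotopic n W G H) : ChartHomotopic n W F H := by
  obtain ⟨f, g, hf, hg, h⟩ := h
  obtain ⟨g', k, hg', hk, h'⟩ := h'
  obtain rfl := hg.unique hg'
  exact ⟨f, k, hf, hk, h.trans h'⟩

theorem Represents.homotopic {W : Set (ℤ × ℤ)} {F G : ℤ × ℤ → ℤ}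
    {f g : C(projProd n '' W, KhalimskyCircle n)} (hf : Represents n W F f)
    (hg : Represents n W G g) (h : ChartHomotopic n W F G) : f.Homotopic g := by
  obtain ⟨f', g', hf', hg', h⟩ := h
  rwa [hf.unique hf', hg.unique hg']

theorem ChartHomotopic.of_kLe [NeZero n] (hn : 3 ≤ n) {W : Set (ℤ × ℤ)} (hW : IsChart W)
    {F G : ℤ × ℤ → ℤ} (hF : Descends n W F) (hG : Descends n W G)
    (h : ∀ w ∈ W, KLe (F w) (G w)) : ChartHomotopic n W F G := by
  obtain ⟨f, hf⟩ := hF.exists_represents hn hW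
  obtain ⟨g, hg⟩ := hG.exists_represents hn hW
  refine ⟨f, g, hf, hg, .of_specializes ?_⟩
  rintro ⟨_, w, hw, rfl⟩
  rw [hf w hw, hg w hw]
  exact specializes_proj (h w hw)

/-- A chain of pointwise comparable functions on a chart gives a homotopy. -/
theorem ChartHomotopic.of_chain [NeZero n] (hn : 3 ≤ n) {W : Set (ℤ × ℤ)} (hW : IsChart W)
    {F : ℤ → ℤ × ℤ → ℤ} {s t : ℤ} (hst : s ≤ t)
    (hF : ∀ r, s ≤ r → r ≤ t → Descends n W (F r))
    (h : ∀ r, s ≤ r → r < t → (∀ w ∈ W, KLe (F r w) (F (r + 1) w)) ∨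
      (∀ w ∈ W, KLe (F (r + 1) w) (F r w))) : ChartHomotopic n W (F s) (F t) := by
  induction t, hst using Int.leInduction with
  | base =>
    exact .of_kLe hn hW (hF s le_rfl le_rfl) (hF s le_rfl le_rfl) fun _ _ => KLe.refl _
  | succ r hr ih =>
    refine (ih (fun q h1 h2 => hF q h1 (by omega)) fun q h1 h2 => h q h1 (by omega)).trans ?_
    rcases h r hr (by omega) with h' | h'
    · exact .of_kLe hn hW (hF r hr (by omega)) (hF _ (by omega) le_rfl) h'
    · exact (ChartHomotopic.of_kLe hn hW (hF _ (by omega) le_rfl) (hF r hr (by omega)) h').symm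

theorem ChartHomotopic.congr {W : Set (ℤ × ℤ)} {F G F' G' : ℤ × ℤ → ℤ}
    (h : ChartHomotopic n W F G) (hF : ∀ w ∈ W, F w = F' w) (hG : ∀ w ∈ W, G w = G' w) :
    ChartHomotopic n W F' G' := by
  obtain ⟨f, g, hf, hg, h⟩ := h
  exact ⟨f, g, fun w hw => by rw [hf w hw, hF w hw], fun w hw => by rw [hg w hw, hG w hw], h⟩

theorem represents_fst (W : Set (ℤ × ℤ)) : Represents n W Prod.fst (fstOn _) := fun _ _ => rfl

theorem represents_snd (W : Set (ℤ × ℤ)) : Represents n W Prod.snd (sndOn _) := fun _ _ => rfl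

/-! ### Upper bound for the category of the torus -/

/-- A square in the Khalimsky plane. -/
def square (c d : ℤ) : Set (ℤ × ℤ) :=
  {w | c ≤ w.1 ∧ w.1 ≤ d ∧ c ≤ w.2 ∧ w.2 ≤ d}

theorem isChart_square {c d : ℤ} (hc : c % 2 = 0) (hd : d % 2 = 0) : IsChart (square c d) := by
  intro x y x' y' h1 h2 h
  simp only [square, Set.mem_ofPred_eq] at h ⊢
  unfold KLe at h1 h2
  omega

theorem eq_of_mem_square {c d : ℤ} (hcd : d < c + 2 * n) {v w : ℤ × ℤ} (hv : v ∈ square c d)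
    (hw : w ∈ square c d) (h1 : proj n v.1 = proj n w.1) (h2 : proj n v.2 = proj n w.2) :
    v = w := by
  simp only [square, Set.mem_ofPred_eq] at hv hw
  have e1 := eq_of_proj_eq_of_lt h1 (by omega) (by omega)
  have e2 := eq_of_proj_eq_of_lt h2 (by omega) (by omega)
  ext <;> omega

/-- Truncation at `t` leads from the constant `c` at `t = c` to the coordinate at `t = d`. The
square is narrower than a period, so no two of its points are glued. -/
theorem chartHomotopic_square_fst [NeZero n] (hn : 3 ≤ n) {c d : ℤ} (hc : c % 2 = 0)
    (hd : d % 2 = 0) (hcd : c ≤ d) (hcd' : d < c + 2 * n) :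
    ChartHomotopic n (square c d) (fun _ => c) Prod.fst := by
  refine (ChartHomotopic.of_chain hn (isChart_square hc hd) (F := fun t w => min w.1 t) hcd
    (fun r _ _ => ⟨fun v _ w _ h _ => h.min (.refl _), fun v hv w hw h1 h2 => ?_⟩)
    fun r _ _ => ?_).congr (fun w hw => ?_) fun w hw => ?_
  · rw [eq_of_mem_square hcd' hv hw h1 h2]
  · exact (KLe.succ r).imp (fun h w _ => (KLe.refl _).min h) fun h w _ => (KLe.refl _).min h
  all_goals
    simp only [square, Set.mem_ofPred_eq] at hw ⊢
    omega

theorem chartHomotopic_square_snd [NeZero n] (hn : 3 ≤ n) {c d : ℤ} (hc : c % 2 = 0)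
    (hd : d % 2 = 0) (hcd : c ≤ d) (hcd' : d < c + 2 * n) :
    ChartHomotopic n (square c d) (fun _ => c) Prod.snd := by
  refine (ChartHomotopic.of_chain hn (isChart_square hc hd) (F := fun t w => min w.2 t) hcd
    (fun r _ _ => ⟨fun v _ w _ _ h => h.min (.refl _), fun v hv w hw h1 h2 => ?_⟩)
    fun r _ _ => ?_).congr (fun w hw => ?_) fun w hw => ?_
  · rw [eq_of_mem_square hcd' hv hw h1 h2]
  · exact (KLe.succ r).imp (fun h w _ => (KLe.refl _).min h) fun h w _ => (KLe.refl _).min h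
  all_goals
    simp only [square, Set.mem_ofPred_eq] at hw ⊢
    omega

theorem represents_const (W : Set (ℤ × ℤ)) (c : ℤ) :
    Represents n W (fun _ => c) (ContinuousMap.const _ (proj n c)) := fun _ _ => rfl

theorem hasSectionOver_square [NeZero n] (hn : 3 ≤ n) {c d : ℤ} (hc : c % 2 = 0)
    (hd : d % 2 = 0) (hcd : c ≤ d) (hcd' : d < c + 2 * n)
    (p : KhalimskyCircle n × KhalimskyCircle n) :
    HasSectionOver (basedPathProjection _ p) (projProd n '' square c d) := by
  refine hasSectionOver_basedPathProjection ?_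
  have h1 := (represents_const _ c).homotopic (represents_fst _)
    (chartHomotopic_square_fst hn hc hd hcd hcd')
  have h2 := (represents_const _ c).homotopic (represents_snd _)
    (chartHomotopic_square_snd hn hc hd hcd hcd')
  have h3 : (ContinuousMap.const (projProd n '' square c d) p).Homotopic
      (ContinuousMap.const (projProd n '' square c d) (proj n c, proj n c)) := by
    obtain ⟨γ⟩ := PathConnectedSpace.joined p (proj n c, proj n c)
    exact ⟨⟨⟨fun q => γ q.1, γ.continuous.comp continuous_fst⟩, fun _ => γ.source,
      fun _ => γ.target⟩⟩
  exact h3.trans (h1.prodMk h2)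

theorem lsCat_le_two (hn : 3 ≤ n) (p : KhalimskyCircle n × KhalimskyCircle n) :
    lsCat (KhalimskyCircle n × KhalimskyCircle n) p ≤ 2 := by
  have : NeZero n := ⟨by omega⟩
  refine sectionalCategory_le (m := 2)
    (fun i => projProd n '' square (2 * i.1 + 2) (2 * i.1 + 2 * n))
    (fun i => isOpen_image_projProd hn (isChart_square (by omega) (by omega)))
    (Set.eq_univ_of_forall ?_)
    fun i => hasSectionOver_square hn (by omega) (by omega) (by omega) (by omega) p
  rintro ⟨x, y⟩
  obtain ⟨k, hk1, hk2, rfl⟩ := exists_proj_eq x 0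
  obtain ⟨l, hl1, hl2, rfl⟩ := exists_proj_eq y 0
  -- Pigeonhole: each coordinate equals at most one of 1, 3, 5, so one of the three squares is left.
  obtain ⟨i, hi⟩ : ∃ i : Fin 3, k ≠ 2 * i.1 + 1 ∧ l ≠ 2 * i.1 + 1 := by
    by_contra! h
    have h0 := h 0
    have h1 := h 1
    have h2 := h 2
    simp only [Fin.val_zero, Fin.val_one, Fin.val_two] at h0 h1 h2
    push_cast at h0 h1 h2
    omega
  have key : ∀ m : ℤ, 0 ≤ m → m < 0 + 2 * n → m ≠ 2 * i.1 + 1 →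
      ∃ m' : ℤ, 2 * i.1 + 2 ≤ m' ∧ m' ≤ 2 * i.1 + 2 * n ∧ proj n m' = proj n m := by
    intro m h1 h2 h3
    by_cases h : 2 * (i.1 : ℤ) + 2 ≤ m
    · exact ⟨m, by omega, by omega, rfl⟩
    · exact ⟨m + 2 * n, by omega, by omega, proj_add m⟩
  obtain ⟨k', h1, h2, h3⟩ := key k hk1 hk2 hi.1
  obtain ⟨l', h4, h5, h6⟩ := key l hl1 hl2 hi.2
  exact Set.mem_iUnion.2 ⟨i, (k', l'), ⟨h1, h2, h4, h5⟩, Prod.ext h3 h6⟩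

/-! ### Motion planning near the diagonal -/

/-- A fundamental domain of a neighbourhood of the diagonal, cut below the diagonal. -/
def diagChart (n : ℕ) : Set (ℤ × ℤ) :=
  {w | (0 ≤ w.1 ∧ w.1 ≤ 2 ∧ 0 ≤ w.2 ∧ w.2 ≤ 2) ∨
    (0 ≤ w.1 ∧ w.1 ≤ 2 * n - 2 ∧ 2 ≤ w.2 ∧ w.2 ≤ 2 * n - 4) ∨
    (2 * n - 4 ≤ w.1 ∧ w.1 ≤ 2 * n - 2 ∧ 2 * n - 4 ≤ w.2 ∧ w.2 ≤ 2 * n) ∨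
    (2 * n - 4 ≤ w.1 ∧ w.1 ≤ 2 * n + 2 ∧ 2 * n - 2 ≤ w.2 ∧ w.2 ≤ 2 * n)}

/-- A fundamental domain of the same neighbourhood of the diagonal, cut above the diagonal. -/
def diagChart' (n : ℕ) : Set (ℤ × ℤ) :=
  {w | (-2 ≤ w.1 ∧ w.1 ≤ 2 ∧ -2 ≤ w.2 ∧ w.2 ≤ 0) ∨
    (0 ≤ w.1 ∧ w.1 ≤ 2 ∧ -2 ≤ w.2 ∧ w.2 ≤ 2) ∨
    (0 ≤ w.1 ∧ w.1 ≤ 2 * n - 2 ∧ 2 ≤ w.2 ∧ w.2 ≤ 2 * n - 4) ∨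
    (2 * n - 4 ≤ w.1 ∧ w.1 ≤ 2 * n - 2 ∧ 2 * n - 4 ≤ w.2 ∧ w.2 ≤ 2 * n)}

theorem isChart_diagChart : IsChart (diagChart n) := by
  intro x y x' y' h1 h2 h
  simp only [diagChart, Set.mem_ofPred_eq] at h ⊢
  unfold KLe at h1 h2
  omega

theorem isChart_diagChart' : IsChart (diagChart' n) := by
  intro x y x' y' h1 h2 h
  simp only [diagChart', Set.mem_ofPred_eq] at h ⊢
  unfold KLe at h1 h2
  omega

/-- The only gluing is that of `[0, 2] × {0}` with its translate by `(2 * n, 2 * n)`, and both edges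
satisfy `y ≤ x`. -/
theorem diagChart_identification (hn : 5 ≤ n) {v w : ℤ × ℤ} (hv : v ∈ diagChart n)
    (hw : w ∈ diagChart n) (h1 : proj n v.1 = proj n w.1) (h2 : proj n v.2 = proj n w.2) :
    v = w ∨ v.2 ≤ v.1 ∧ w.2 ≤ w.1 := by
  simp only [diagChart, Set.mem_ofPred_eq] at hv hw
  have e1 := eq_of_proj_eq_of_lt h1 (by omega) (by omega)
  have e2 := eq_of_proj_eq_of_lt h2 (by omega) (by omega)
  rw [Prod.ext_iff]
  omega

theorem diagChart'_identification (hn : 5 ≤ n) {v w : ℤ × ℤ} (hv : v ∈ diagChart' n)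
    (hw : w ∈ diagChart' n) (h1 : proj n v.1 = proj n w.1) (h2 : proj n v.2 = proj n w.2) :
    v = w ∨ v.1 ≤ v.2 ∧ w.1 ≤ w.2 := by
  simp only [diagChart', Set.mem_ofPred_eq] at hv hw
  have e1 := eq_of_proj_eq_of_lt h1 (by omega) (by omega)
  have e2 := eq_of_proj_eq_of_lt h2 (by omega) (by omega)
  rw [Prod.ext_iff]
  omega

theorem mem_diagChart'_of_mem_diagChart (hn : 5 ≤ n) {w : ℤ × ℤ} (hw : w ∈ diagChart n) :
    w ∈ diagChart' n ∨ (w.1 - 2 * n, w.2 - 2 * n) ∈ diagChart' n := by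
  simp only [diagChart, diagChart', Set.mem_ofPred_eq] at hw ⊢
  omega

/-- Where points are glued the second coordinate does not exceed the first, so the homotopy is
stationary there and descends. The limits of `t` bound all coordinates in the chart. -/
theorem chartHomotopic_diagChart (hn : 5 ≤ n) :
    ChartHomotopic n (diagChart n) Prod.fst (fun w => max w.1 w.2) := by
  have : NeZero n := ⟨by omega⟩
  refine (ChartHomotopic.of_chain (by omega) isChart_diagChart (s := -2) (t := 2 * n + 2)
    (F := fun t w => max w.1 (min w.2 t)) (by omega)
    (fun r _ _ => ⟨fun v _ w _ h h' => h.max (h'.min (.refl _)), fun v hv w hw h1 h2 => ?_⟩)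
    fun r _ _ => ?_).congr (fun w hw => ?_) fun w hw => ?_
  · rcases diagChart_identification hn hv hw h1 h2 with rfl | ⟨h, h'⟩
    · rfl
    · rwa [max_eq_left ((min_le_left _ _).trans h), max_eq_left ((min_le_left _ _).trans h')]
  · exact (KLe.succ r).imp (fun h w _ => (KLe.refl _).max ((KLe.refl _).min h))
      fun h w _ => (KLe.refl _).max ((KLe.refl _).min h)
  all_goals
    simp only [diagChart, Set.mem_ofPred_eq] at hw ⊢
    omega

theorem chartHomotopic_diagChart' (hn : 5 ≤ n) :
    ChartHomotopic n (diagChart' n) Prod.snd (fun w => max w.1 w.2) := by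
  have : NeZero n := ⟨by omega⟩
  refine (ChartHomotopic.of_chain (by omega) isChart_diagChart' (s := -2) (t := 2 * n + 2)
    (F := fun t w => max w.2 (min w.1 t)) (by omega)
    (fun r _ _ => ⟨fun v _ w _ h h' => h'.max (h.min (.refl _)), fun v hv w hw h1 h2 => ?_⟩)
    fun r _ _ => ?_).congr (fun w hw => ?_) fun w hw => ?_
  · rcases diagChart'_identification hn hv hw h1 h2 with rfl | ⟨h, h'⟩
    · rfl
    · rwa [max_eq_left ((min_le_left _ _).trans h), max_eq_left ((min_le_left _ _).trans h')]
  · exact (KLe.succ r).imp (fun h w _ => (KLe.refl _).max ((KLe.refl _).min h))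
      fun h w _ => (KLe.refl _).max ((KLe.refl _).min h)
  all_goals
    simp only [diagChart', Set.mem_ofPred_eq] at hw ⊢
    omega

theorem proj_sub (k : ℤ) : proj n (k - 2 * n) = proj n k := by
  rw [← proj_add (k - 2 * n), sub_add_cancel]

theorem hasSectionOver_diagChart (hn : 5 ≤ n) :
    HasSectionOver (pathProjection _) (projProd n '' diagChart n) := by
  refine hasSectionOver_pathProjection ?_
  have hsub : projProd n '' diagChart n ⊆ projProd n '' diagChart' n := by
    rintro _ ⟨w, hw, rfl⟩
    rcases mem_diagChart'_of_mem_diagChart hn hw with h | h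
    · exact ⟨w, h, rfl⟩
    · exact ⟨_, h, Prod.ext (proj_sub _) (proj_sub _)⟩
  obtain ⟨f, g, hf, hg, h⟩ := chartHomotopic_diagChart hn
  obtain ⟨f', g', hf', hg', h'⟩ := chartHomotopic_diagChart' hn
  obtain rfl := hf.unique (represents_fst _)
  obtain rfl := hf'.unique (represents_snd _)
  let i : C(projProd n '' diagChart n, projProd n '' diagChart' n) :=
    ⟨Set.inclusion hsub, continuous_inclusion hsub⟩
  -- The maximum commutes with the translation by `(2 * n, 2 * n)`, so both charts yield the same
  -- intermediate map.
  have e : g'.comp i = g := by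
    refine Represents.unique (F := fun w => max w.1 w.2) (fun w hw => ?_) hg
    rcases mem_diagChart'_of_mem_diagChart hn hw with h | h
    · exact hg' w h
    · have e1 := hg' _ h
      have e2 : projProd n (w.1 - 2 * n, w.2 - 2 * n) = projProd n w :=
        Prod.ext (proj_sub _) (proj_sub _)
      simp only [e2, max_sub_sub_right, proj_sub] at e1
      exact e1
  have h2 : (sndOn (projProd n '' diagChart n)).Homotopic (g'.comp i) :=
    h'.comp (ContinuousMap.Homotopic.refl i)
  rw [e] at h2
  exact h.trans h2.symm

/-! ### Motion planning away from the diagonal -/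

/-- A fundamental domain of an annulus in the complement of the diagonal. -/
def awayChart (n : ℕ) : Set (ℤ × ℤ) :=
  {w | (2 * n - 2 ≤ w.1 ∧ w.1 ≤ 2 * n ∧ 2 ≤ w.2 ∧ w.2 ≤ 2 * n - 2) ∨
    (2 * n ≤ w.1 ∧ w.1 ≤ 4 * n - 4 ∧ 2 * n - 4 ≤ w.2 ∧ w.2 ≤ 2 * n - 2) ∨
    (2 * n + 2 ≤ w.1 ∧ w.1 ≤ 4 * n - 4 ∧ 2 * n - 4 ≤ w.2 ∧ w.2 ≤ 2 * n + 2) ∨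
    (2 * n + 2 ≤ w.1 ∧ w.1 ≤ 4 * n ∧ 2 * n ≤ w.2 ∧ w.2 ≤ 2 * n + 2)}

/-- A degree one map from the annulus `awayChart` to a circle that is longer than the original
one. -/
def awayHeight (n : ℕ) (w : ℤ × ℤ) : ℤ :=
  min w.2 (2 * n - 4) + max (2 * (n : ℤ)) (min w.1 (4 * n - 2)) - 2 * n - 2

theorem isChart_awayChart : IsChart (awayChart n) := by
  intro x y x' y' h1 h2 h
  simp only [awayChart, Set.mem_ofPred_eq] at h ⊢
  unfold KLe at h1 h2
  omega

theorem kLe_awayHeight {v w : ℤ × ℤ}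
    (hw : w ∈ awayChart n) (h1 : KLe v.1 w.1) (h2 : KLe v.2 w.2) :
    KLe (awayHeight n v) (awayHeight n w) := by
  simp only [awayChart, Set.mem_ofPred_eq] at hw
  unfold awayHeight
  -- Sums need not preserve `KLe`; here, for comparable points, one summand is frozen at the same
  -- even value, and only the other varies.
  have hx : max (2 * (n : ℤ)) (min v.1 (4 * n - 2)) = 2 * n ∧
      max (2 * (n : ℤ)) (min w.1 (4 * n - 2)) = 2 * n ∨
      min v.2 (2 * (n : ℤ) - 4) = 2 * n - 4 ∧ min w.2 (2 * (n : ℤ) - 4) = 2 * n - 4 := by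
    unfold KLe at h1 h2
    omega
  rcases hx with ⟨e1, e2⟩ | ⟨e1, e2⟩
  · rw [e1, e2]
    have := (h2.min (KLe.refl (2 * (n : ℤ) - 4))).add_even (c := -2) (by norm_num)
    convert this using 1 <;> ring
  · rw [e1, e2]
    have := ((KLe.refl (2 * (n : ℤ))).max (h1.min (KLe.refl (4 * (n : ℤ) - 2)))).add_even
      (c := -6) (by norm_num)
    convert this using 1 <;> ring

theorem awayHeight_mem (hn : 5 ≤ n) {w : ℤ × ℤ} (hw : w ∈ awayChart n) :
    0 ≤ awayHeight n w ∧ awayHeight n w ≤ 4 * n - 8 := by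
  simp only [awayChart, Set.mem_ofPred_eq] at hw
  unfold awayHeight
  omega

theorem awayChart_identification (hn : 5 ≤ n) {v w : ℤ × ℤ} (hv : v ∈ awayChart n)
    (hw : w ∈ awayChart n) (h1 : proj n v.1 = proj n w.1) (h2 : proj n v.2 = proj n w.2) :
    v = w ∨
    (w.1 = v.1 + 2 * n ∧ w.2 = v.2 + 2 * n ∧ awayHeight n v = 0 ∧ awayHeight n w = 4 * n - 8) ∨
    (v.1 = w.1 + 2 * n ∧ v.2 = w.2 + 2 * n ∧ awayHeight n w = 0 ∧ awayHeight n v = 4 * n - 8) := by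
  simp only [awayChart, Set.mem_ofPred_eq] at hv hw
  have e1 := eq_of_proj_eq_of_lt h1 (by omega) (by omega)
  have e2 := eq_of_proj_eq_of_lt h2 (by omega) (by omega)
  rw [Prod.ext_iff]
  have key : (v.1 = w.1 ∧ v.2 = w.2) ∨
      (w.1 = v.1 + 2 * n ∧ w.2 = v.2 + 2 * n ∧ v.2 = 2 ∧ v.1 ≤ 2 * n ∧ 4 * n - 2 ≤ w.1) ∨
      (v.1 = w.1 + 2 * n ∧ v.2 = w.2 + 2 * n ∧ w.2 = 2 ∧ w.1 ≤ 2 * n ∧ 4 * n - 2 ≤ v.1) := by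
    omega
  unfold awayHeight
  omega

/-- The map that follows the profile `ψ` of the height as long as it lies between the two
coordinates. -/
def awayMap (n : ℕ) (ψ : ℤ → ℤ) (w : ℤ × ℤ) : ℤ := max w.2 (min w.1 (ψ (awayHeight n w)))

/-- Distinct glued points differ by `(2 * n, 2 * n)` and lie at the two extreme heights. Clamping
commutes with this translation, so `ψ` only has to gain one period between these heights. -/
theorem descends_awayMap (hn : 5 ≤ n) {ψ : ℤ → ℤ} (hψ : ∀ h k, KLe h k → KLe (ψ h) (ψ k))
    (hψ' : ψ (4 * n - 8) = ψ 0 + 2 * n) : Descends n (awayChart n) (awayMap n ψ) where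
  mono v hv w hw h1 h2 := h2.max (h1.min (hψ _ _ (kLe_awayHeight hw h1 h2)))
  compat v hv w hw h1 h2 := by
    unfold awayMap
    rcases awayChart_identification hn hv hw h1 h2 with rfl | ⟨e1, e2, e3, e4⟩ | ⟨e1, e2, e3, e4⟩
    · rfl
    · rw [e1, e2, e3, e4, hψ', min_add_add_right, max_add_add_right, proj_add]
    · rw [e1, e2, e3, e4, hψ', min_add_add_right, max_add_add_right, proj_add]

/-- A family of profiles that rotates the long circle around the original one. -/
def profile (n : ℕ) (c t j h : ℤ) : ℤ :=
  max c (min (max h (min (h + 2) t)) (c + 2 * n)) + 2 * j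

/-- The end values are `c + 2 * j` and `c + 2 * n + 2 * j`. The upper one uses `4 * n - 8 ≥ 2 * n +
2`; for the lower one the disjunction keeps the shift by 2 from exceeding `c` at height 0. -/
theorem descends_profile (hn : 5 ≤ n) {c t j : ℤ} (hc : 0 ≤ c) (hc' : c ≤ 2) (ht : 0 ≤ t)
    (h : c = 2 ∨ t = 0) : Descends n (awayChart n) (awayMap n (profile n c t j)) := by
  refine descends_awayMap hn (fun h k hk => ?_) ?_
  · exact (((KLe.refl c).max ((hk.max ((hk.add_even (by norm_num)).min (.refl t))).min
      (.refl _)))).add_even (by omega)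
  · unfold profile
    omega

theorem awayMap_congr {ψ ψ' : ℤ → ℤ} (h : (∀ k, KLe (ψ k) (ψ' k)) ∨ (∀ k, KLe (ψ' k) (ψ k)))
    (W : Set (ℤ × ℤ)) : (∀ w ∈ W, KLe (awayMap n ψ w) (awayMap n ψ' w)) ∨
      (∀ w ∈ W, KLe (awayMap n ψ' w) (awayMap n ψ w)) :=
  h.imp (fun h _ _ => (KLe.refl _).max ((KLe.refl _).min (h _)))
    fun h _ _ => (KLe.refl _).max ((KLe.refl _).min (h _))

/-- First the window `[c, c + 2 * n]` rises by 2, using up the slack of the long circle. Then a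
front `t` sweeps through the heights and replaces `h` by `h + 2` behind it; at `t = 4 * n` it has
passed every height. -/
theorem chartHomotopic_profile_succ (hn : 5 ≤ n) (j : ℤ) :
    ChartHomotopic n (awayChart n) (awayMap n (profile n 0 0 j))
      (awayMap n (profile n 0 0 (j + 1))) := by
  have : NeZero n := ⟨by omega⟩
  have h1 := ChartHomotopic.of_chain (by omega) isChart_awayChart
    (F := fun c => awayMap n (profile n c 0 j)) (show (0 : ℤ) ≤ 2 by norm_num)
    (fun c hc hc' => descends_profile hn hc hc' le_rfl (.inr rfl)) fun c _ _ => by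
      refine awayMap_congr ?_ _
      unfold profile
      rcases KLe.succ c with h | h
      · refine .inl fun k => (h.max ((KLe.refl _).min ?_)).add_even (by omega)
        convert! h.add_even (c := 2 * (n : ℤ)) (by omega) using 1
      · refine .inr fun k => (h.max ((KLe.refl _).min ?_)).add_even (by omega)
        convert! h.add_even (c := 2 * (n : ℤ)) (by omega) using 1
  have h2 := ChartHomotopic.of_chain (by omega) isChart_awayChart
    (F := fun t => awayMap n (profile n 2 t j)) (show (0 : ℤ) ≤ 4 * n by omega)
    (fun t ht _ => descends_profile hn (by norm_num) le_rfl ht (.inl rfl)) fun t _ _ => by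
      refine awayMap_congr ?_ _
      unfold profile
      rcases KLe.succ t with h | h
      · exact .inl fun k => ((KLe.refl _).max (((KLe.refl _).max
          ((KLe.refl _).min h)).min (.refl _))).add_even (by omega)
      · exact .inr fun k => ((KLe.refl _).max (((KLe.refl _).max
          ((KLe.refl _).min h)).min (.refl _))).add_even (by omega)
  refine (h1.trans h2).congr (fun _ _ => rfl) fun w hw => ?_
  obtain ⟨h3, h4⟩ := awayHeight_mem hn hw
  have : profile n 2 (4 * n) j (awayHeight n w) = profile n 0 0 (j + 1) (awayHeight n w) := by
    unfold profile
    omega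
  simp only [awayMap, this]

theorem chartHomotopic_profile (hn : 5 ≤ n) {i j : ℤ} (hij : i ≤ j) :
    ChartHomotopic n (awayChart n) (awayMap n (profile n 0 0 i)) (awayMap n (profile n 0 0 j)) := by
  have : NeZero n := ⟨by omega⟩
  induction j, hij using Int.leInduction with
  | base =>
    have h := descends_profile (j := i) hn le_rfl (by norm_num) le_rfl (.inr rfl)
    exact .of_kLe (by omega) isChart_awayChart h h fun _ _ => .refl _
  | succ j _ ih => exact ih.trans (chartHomotopic_profile_succ hn j)

theorem hasSectionOver_awayChart (hn : 5 ≤ n) :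
    HasSectionOver (pathProjection _) (projProd n '' awayChart n) := by
  refine hasSectionOver_pathProjection ((represents_snd _).homotopic (represents_fst _) ?_).symm
  -- For `j = -n` the profile is at most 0, below every `y`, and the clamp gives `y`; for `j = 2 *
  -- n` it is at least `4 * n`, no smaller than any `x`, and the clamp gives `x`.
  refine (chartHomotopic_profile hn (show -(n : ℤ) ≤ 2 * n by omega)).congr
    (fun w hw => ?_) fun w hw => ?_
  all_goals
    simp only [awayChart, Set.mem_ofPred_eq] at hw
    unfold awayMap profile
    omega

theorem diagChart_union_awayChart (hn : 5 ≤ n) (u : KhalimskyCircle n × KhalimskyCircle n) :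
    u ∈ projProd n '' diagChart n ∨ u ∈ projProd n '' awayChart n := by
  have : NeZero n := ⟨by omega⟩
  obtain ⟨x, y⟩ := u
  obtain ⟨k, hk1, hk2, rfl⟩ := exists_proj_eq x 0
  obtain ⟨l, hl1, hl2, rfl⟩ := exists_proj_eq y 0
  have h : (k, l) ∈ diagChart n ∨ (k + 2 * n, l) ∈ diagChart n ∨ (k, l) ∈ awayChart n ∨
      (k + 2 * n, l) ∈ awayChart n ∨ (k + 2 * n, l + 2 * n) ∈ awayChart n := by
    simp only [diagChart, awayChart, Set.mem_ofPred_eq]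
    by_cases h1 : l ≤ 2
    · by_cases h2 : k ≤ 2
      · exact .inl (.inl (by omega))
      · exact .inr (.inr (.inr (.inr (.inr (.inr (.inr (by omega)))))))
    by_cases h2 : k ≤ 2 * n - 2
    · by_cases h3 : l ≤ 2 * n - 4
      · exact .inl (.inr (.inl (by omega)))
      by_cases h4 : 2 * n - 4 ≤ k
      · exact .inl (.inr (.inr (.inl (by omega))))
      by_cases h5 : l ≤ 2 * n - 2
      · exact .inr (.inr (.inr (.inl (.inr (.inl (by omega))))))
      by_cases h6 : k ≤ 2
      · exact .inr (.inl (.inr (.inr (.inr (by omega)))))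
      · exact .inr (.inr (.inr (.inl (.inr (.inr (.inl (by omega)))))))
    · by_cases h3 : l ≤ 2 * n - 2
      · exact .inr (.inr (.inl (.inl (by omega))))
      · exact .inl (.inr (.inr (.inr (by omega))))
  rcases h with h | h | h | h | h
  · exact .inl ⟨_, h, rfl⟩
  · exact .inl ⟨_, h, Prod.ext (proj_add _) rfl⟩
  · exact .inr ⟨_, h, rfl⟩
  · exact .inr ⟨_, h, Prod.ext (proj_add _) rfl⟩
  · exact .inr ⟨_, h, Prod.ext (proj_add _) (proj_add _)⟩

theorem tc_le_one (hn : 5 ≤ n) : tc (KhalimskyCircle n) ≤ 1 := by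
  have : NeZero n := ⟨by omega⟩
  refine sectionalCategory_le (m := 1)
    (fun i => projProd n '' (if i = 0 then diagChart n else awayChart n)) (fun i => ?_)
    (Set.eq_univ_of_forall fun u => Set.mem_iUnion.2 ?_) fun i => ?_
  · split_ifs
    · exact isOpen_image_projProd (by omega) isChart_diagChart
    · exact isOpen_image_projProd (by omega) isChart_awayChart
  · exact (diagChart_union_awayChart hn u).elim (fun h => ⟨0, h⟩) fun h => ⟨1, h⟩
  · split_ifs
    · exact hasSectionOver_diagChart hn
    · exact hasSectionOver_awayChart hn

end KhalimskyCircle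

/-! ### The universal covering of the Khalimsky circle -/

/-- The Khalimsky line, in which the even integers are open points. -/
def KhalimskyLine : Type := ℤ

namespace KhalimskyLine

instance : TopologicalSpace KhalimskyLine where
  IsOpen s := ∀ k l : ℤ, KLe k l → s l → s k
  isOpen_univ := fun _ _ _ _ => trivial
  isOpen_inter := fun _ _ hs ht k l h hl => ⟨hs k l h hl.1, ht k l h hl.2⟩
  isOpen_sUnion := fun _ hS k l h ⟨s, hs, hl⟩ => ⟨s, hs, hS s hs k l h hl⟩

theorem isOpen_iff {s : Set KhalimskyLine} :
    IsOpen s ↔ ∀ k l : ℤ, KLe k l → (show KhalimskyLine from l) ∈ s →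
      (show KhalimskyLine from k) ∈ s := Iff.rfl

theorem isOpen_downset (l : ℤ) : IsOpen {k : KhalimskyLine | KLe k l} :=
  isOpen_iff.2 fun _ _ h h' => h.trans h'

theorem kLe_of_specializes {k l : KhalimskyLine} (h : k ⤳ l) : KLe k l :=
  h.mem_open (isOpen_downset l) (KLe.refl l)

end KhalimskyLine

namespace KhalimskyCircle

variable {n : ℕ}

/-- The covering projection, with the Khalimsky topology on its source. -/
def cover (n : ℕ) (k : KhalimskyLine) : KhalimskyCircle n := proj n k

theorem continuous_cover : Continuous (cover n) :=
  continuous_def.2 fun _ hO => KhalimskyLine.isOpen_iff.2 fun _ _ h hl =>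
    (specializes_proj h).mem_open hO hl

theorem isOpenMap_cover (hn : 3 ≤ n) : IsOpenMap (cover n) := by
  have : NeZero n := ⟨by omega⟩
  intro O hO
  rw [isOpen_iff_forall_specializes]
  rintro x _ h ⟨l, hl, rfl⟩
  obtain ⟨k, hk, rfl⟩ := exists_of_specializes_proj hn h
  exact ⟨k, hO k l hk hl, rfl⟩

theorem isCoveringMap_cover (hn : 3 ≤ n) : IsCoveringMap (cover n) := by
  let : AddAction ℤ KhalimskyLine :=
    { vadd := fun m (k : ℤ) => (k + 2 * n * m : ℤ)
      zero_vadd := fun (k : ℤ) => show (k + 2 * n * 0 : ℤ) = k by ring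
      add_vadd := fun m m' (k : ℤ) =>
        show (k + 2 * n * (m + m') : ℤ) = k + 2 * n * m' + 2 * n * m by ring }
  refine IsAddQuotientCoveringMap.isCoveringMap (f := cover n) ℤ ?_
  refine
    { toIsQuotientMap := (isOpenMap_cover hn).isQuotientMap continuous_cover (proj_surjective n)
      continuous_const_vadd := fun m => continuous_def.2 fun O hO =>
        KhalimskyLine.isOpen_iff.2 fun k l h hl =>
          hO _ _ (h.add_even (c := 2 * n * m) (by rw [mul_assoc]; omega)) hl
      apply_eq_iff_mem_orbit := fun {k l} => ?_
      -- The smallest neighbourhood of `l` lies in `[l - 1, l + 1]`, so translation by a nonzero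
      -- multiple of `2 * n ≥ 6` moves it off itself.
      disjoint := fun l => ⟨{k | KLe k l},
        (KhalimskyLine.isOpen_downset l).mem_nhds (KLe.refl l), ?_⟩ }
  · constructor
    · intro h
      obtain ⟨m, hm⟩ := proj_eq_iff.1 (show proj n l = proj n k from h.symm)
      exact ⟨m, hm.symm⟩
    · rintro ⟨m, rfl⟩
      exact proj_add_period (n := n) l m
  · rintro m ⟨_, ⟨(k : ℤ), hk, rfl⟩, hk'⟩
    change KLe k l at hk
    change KLe (k + 2 * n * m : ℤ) l at hk'
    have h : -2 ≤ 2 * (n : ℤ) * m ∧ 2 * (n : ℤ) * m ≤ 2 := by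
      unfold KLe at hk hk'
      generalize 2 * (n : ℤ) * m = r at *
      omega
    have hn' : (3 : ℤ) ≤ n := by exact_mod_cast hn
    rcases lt_trichotomy m 0 with h0 | h0 | h0
    · nlinarith
    · exact h0
    · nlinarith

/-- A map that is joined to a constant map by a continuous family of paths lifts to the
Khalimsky line. -/
theorem exists_lift (hn : 3 ≤ n) {A : Type*} [TopologicalSpace A] (x : KhalimskyCircle n)
    (s : C(A, C(I, KhalimskyCircle n))) (hs : ∀ u, s u 0 = x) :
    ∃ φ : A → ℤ, (∀ u v, u ⤳ v → KLe (φ u) (φ v)) ∧ ∀ u, proj n (φ u) = s u 1 := by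
  obtain ⟨k, rfl⟩ := proj_surjective n x
  let H : C(I × A, KhalimskyCircle n) :=
    ⟨fun q => s q.2 q.1, by fun_prop⟩
  let f : C(A, KhalimskyLine) := ContinuousMap.const A k
  have hH : ∀ u, H (0, u) = cover n (f u) := hs
  let L := (isCoveringMap_cover hn).liftHomotopy H f hH
  refine ⟨fun u => L (1, u), fun u v h => ?_, fun u => ?_⟩
  · exact KhalimskyLine.kLe_of_specializes
      ((specializes_rfl.prod h : ((1 : I), u) ⤳ ((1 : I), v)).map L.continuous)
  · exact congrFun ((isCoveringMap_cover hn).liftHomotopy_lifts H f hH) (1, u)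

/-! ### Lower bounds -/

/-- Local constancy of the winding number of a lift. -/
theorem winding_eq (hn : 3 ≤ n) {k l k' l' : ℤ} (h : KLe k l) (h' : KLe k' l')
    (hk : proj n k' = proj n k) (hl : proj n l' = proj n l) :
    (k' - k) / (2 * n) = (l' - l) / (2 * n) := by
  obtain ⟨r, rfl⟩ := proj_eq_iff.1 hk.symm
  obtain ⟨s, rfl⟩ := proj_eq_iff.1 hl.symm
  have h0 : (2 * (n : ℤ)) ≠ 0 := by omega
  rw [add_sub_cancel_left, add_sub_cancel_left, Int.mul_ediv_cancel_left _ h0,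
    Int.mul_ediv_cancel_left _ h0]
  -- Both differences are multiples of `2 * n`, and each of the two points moves by at most 1.
  have e : -2 ≤ 2 * (n : ℤ) * (s - r) ∧ 2 * (n : ℤ) * (s - r) ≤ 2 := by
    rw [mul_sub]
    unfold KLe at h h'
    generalize 2 * (n : ℤ) * r = r' at *
    generalize 2 * (n : ℤ) * s = s' at *
    omega
  have hn' : (3 : ℤ) ≤ n := by exact_mod_cast hn
  rcases lt_trichotomy (s - r) 0 with h1 | h1 | h1
  · nlinarith
  · omega
  · nlinarith

theorem one_le_tc (hn : 3 ≤ n) : 1 ≤ tc (KhalimskyCircle n) := by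
  refine le_sectionalCategory (m := 1) ?_
  rintro ⟨U, -, hU, hs⟩
  obtain ⟨s, hs⟩ := hs 0
  have hU' : ∀ u, u ∈ U 0 := fun u => by
    obtain ⟨i, hi⟩ := Set.mem_iUnion.1 (hU.symm ▸ Set.mem_univ u : u ∈ ⋃ i, U i)
    rwa [Subsingleton.elim i 0] at hi
  -- On this slice a global section would contract the circle.
  let j : C(KhalimskyCircle n, U 0) :=
    ⟨fun x => ⟨(proj n 0, x), hU' _⟩, by fun_prop⟩
  obtain ⟨φ, hφ, hφ'⟩ := exists_lift hn (proj n 0) (s.comp j)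
    fun x => congrArg Prod.fst (hs (j x))
  have h1 : ∀ k, proj n (φ (proj n k)) = proj n k := fun k =>
    (hφ' _).trans (congrArg Prod.snd (hs (j (proj n k))))
  have h2 : ∀ k, (φ (proj n k) - k) / (2 * n) = (φ (proj n 0) - 0) / (2 * n) := fun k => by
    have step : ∀ k, (φ (proj n k) - k) / (2 * n) = (φ (proj n (k + 1)) - (k + 1)) / (2 * n) :=
      fun k => by
        rcases KLe.succ k with h | h
        · exact winding_eq hn h (hφ _ _ (specializes_proj h)) (h1 _) (h1 _)
        · exact (winding_eq hn h (hφ _ _ (specializes_proj h)) (h1 _) (h1 _)).symm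
    induction k using Int.induction_on with
    | zero => rfl
    | succ i ih => exact (step _).symm.trans ih
    | pred i ih =>
      refine Eq.trans ?_ ih
      simpa using step (-(i : ℤ) - 1)
  -- Going once around returns to the same lifted value while `k` grows by a period, so the constant
  -- winding number would drop by 1.
  have h3 := h2 (2 * n)
  have h4 : proj n (2 * n) = proj n 0 := by simpa using proj_add (n := n) 0
  rw [h4] at h3
  have h0 : (2 * (n : ℤ)) ≠ 0 := by omega
  have h5 := Int.sub_ediv_of_dvd (φ (proj n 0)) (dvd_refl (2 * (n : ℤ)))
  rw [h3, Int.ediv_self h0, sub_zero] at h5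
  omega

/-- A discrete form of the fact that the classes of the two coordinates of the torus have a
non-trivial cup product. -/
theorem exists_square_of_winding {N : ℕ} {c d : ℤ → ℤ → ℤ}
    (hc1 : ∀ x y, c (x + N) y = c x y - 1) (hc2 : ∀ x y, c x (y + N) = c x y)
    (hd1 : ∀ x y, d (x + N) y = d x y) (hd2 : ∀ x y, d x (y + N) = d x y - 1) :
    ∃ x y, (c (x + 1) y - c x y) * (d (x + 1) (y + 1) - d (x + 1) y) -
      (c x (y + 1) - c x y) * (d (x + 1) (y + 1) - d x (y + 1)) ≠ 0 := by
  by_contra! h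
  -- The cup product is the coboundary of `c` times the differences of `d`; one half telescopes in
  -- `x` with total 1, the other in `y` with total 0.
  have h1 : ∑ x ∈ Finset.range N, ∑ y ∈ Finset.range N,
      ((c (x + 1 : ℕ) y * (d (x + 1 : ℕ) (y + 1 : ℕ) - d (x + 1 : ℕ) y) -
          c x y * (d x (y + 1 : ℕ) - d x y)) -
        (c x (y + 1 : ℕ) * (d (x + 1 : ℕ) (y + 1 : ℕ) - d x (y + 1 : ℕ)) -
          c x y * (d (x + 1 : ℕ) y - d x y))) = 0 := by
    refine Finset.sum_eq_zero fun x _ => Finset.sum_eq_zero fun y _ => ?_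
    have := h x y
    push_cast
    linear_combination this
  have h2 : ∑ x ∈ Finset.range N, ∑ y ∈ Finset.range N,
      (c (x + 1 : ℕ) y * (d (x + 1 : ℕ) (y + 1 : ℕ) - d (x + 1 : ℕ) y) -
          c x y * (d x (y + 1 : ℕ) - d x y)) = 1 := by
    rw [Finset.sum_comm]
    have e : ∀ y ∈ Finset.range N, ∑ x ∈ Finset.range N,
        (c (x + 1 : ℕ) y * (d (x + 1 : ℕ) (y + 1 : ℕ) - d (x + 1 : ℕ) y) -
          c x y * (d x (y + 1 : ℕ) - d x y)) = d 0 y - d 0 (y + 1 : ℕ) := fun y _ => by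
      rw [Finset.sum_range_sub (fun x : ℕ => c x y * (d x (y + 1 : ℕ) - d x y))]
      have e1 := hc1 0 y
      have e2 := hd1 0 y
      have e3 := hd1 0 (y + 1 : ℕ)
      rw [zero_add] at e1 e2 e3
      rw [e1, e2, e3]
      push_cast
      ring
    rw [Finset.sum_congr rfl e, Finset.sum_range_sub' (fun y : ℕ => d 0 y)]
    have := hd2 0 0
    rw [zero_add] at this
    rw [this]
    push_cast
    ring
  have h3 : ∑ x ∈ Finset.range N, ∑ y ∈ Finset.range N,
      (c x (y + 1 : ℕ) * (d (x + 1 : ℕ) (y + 1 : ℕ) - d x (y + 1 : ℕ)) -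
          c x y * (d (x + 1 : ℕ) y - d x y)) = 0 := by
    refine Finset.sum_eq_zero fun x _ => ?_
    rw [Finset.sum_range_sub (fun y : ℕ => c x y * (d (x + 1 : ℕ) y - d x y))]
    have e1 := hc2 x 0
    have e2 := hd2 (x + 1 : ℕ) 0
    have e3 := hd2 x 0
    rw [zero_add] at e1 e2 e3
    rw [e1, e2, e3]
    push_cast
    ring
  simp only [Finset.sum_sub_distrib] at h1 h2 h3
  omega

/-- An open set of the torus over which one coordinate is null-homotopic carries a winding
number of that coordinate. -/
theorem exists_winding (hn : 3 ≤ n) {U : Set (KhalimskyCircle n × KhalimskyCircle n)}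
    (x : KhalimskyCircle n) (π : KhalimskyCircle n × KhalimskyCircle n → KhalimskyCircle n)
    (e : ℤ × ℤ → ℤ) (he : ∀ w, π (projProd n w) = proj n (e w))
    (he' : ∀ v w : ℤ × ℤ, KLe v.1 w.1 → KLe v.2 w.2 → KLe (e v) (e w))
    (s : C(U, C(I, KhalimskyCircle n))) (hs : ∀ u, s u 0 = x) (hs' : ∀ u : U, s u 1 = π u) :
    ∃ c : ℤ × ℤ → ℤ,
      (∀ v w r, projProd n v = projProd n w → e w = e v + 2 * n * r → c w = c v - r) ∧
      ∀ v w, KLe v.1 w.1 → KLe v.2 w.2 → projProd n v ∈ U → projProd n w ∈ U → c v = c w := by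
  classical
  obtain ⟨φ, hφ, hφ'⟩ := exists_lift hn x s hs
  have h0 : (2 * (n : ℤ)) ≠ 0 := by omega
  -- The value 0 off `U` is arbitrary: the periodicity of `c` uses only that `ψ` depends on the
  -- point of the torus, and constancy is claimed only inside `U`.
  let ψ : KhalimskyCircle n × KhalimskyCircle n → ℤ := fun u => if h : u ∈ U then φ ⟨u, h⟩ else 0
  refine ⟨fun w => (ψ (projProd n w) - e w) / (2 * n), fun v w r h h' => ?_,
    fun v w h1 h2 hv hw => ?_⟩
  · simp only
    rw [h', ← h, ← sub_sub, Int.sub_ediv_of_dvd _ (dvd_mul_right _ _),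
      Int.mul_ediv_cancel_left _ h0]
  · simp only [ψ, dif_pos hv, dif_pos hw]
    refine winding_eq hn (he' _ _ h1 h2) (hφ _ _ ?_) ((hφ' _).trans ((hs' _).trans (he _)))
      ((hφ' _).trans ((hs' _).trans (he _)))
    rw [subtype_specializes_iff]
    exact (specializes_proj h1).prod (specializes_proj h2)

theorem two_le_lsCat (hn : 3 ≤ n) (p : KhalimskyCircle n × KhalimskyCircle n) :
    2 ≤ lsCat (KhalimskyCircle n × KhalimskyCircle n) p := by
  refine le_sectionalCategory (m := 2) ?_
  rintro ⟨U, hUo, hU, hs⟩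
  obtain ⟨s, hs0⟩ := hs 0
  obtain ⟨t, ht⟩ := hs 1
  obtain ⟨c, hc, hc'⟩ := exists_winding hn (U := U 0) p.1 Prod.fst Prod.fst (fun _ => rfl)
    (fun _ _ h _ => h) ⟨fun u => (ContinuousMap.mk Prod.fst continuous_fst).comp (s u).1,
      (ContinuousMap.continuous_postcomp _).comp (continuous_subtype_val.comp s.continuous)⟩
    (fun u => congrArg Prod.fst (s u).2) (fun u => congrArg Prod.fst (hs0 u))
  obtain ⟨d, hd, hd'⟩ := exists_winding hn (U := U 1) p.2 Prod.snd Prod.snd (fun _ => rfl)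
    (fun _ _ _ h => h) ⟨fun u => (ContinuousMap.mk Prod.snd continuous_snd).comp (t u).1,
      (ContinuousMap.continuous_postcomp _).comp (continuous_subtype_val.comp t.continuous)⟩
    (fun u => congrArg Prod.snd (t u).2) (fun u => congrArg Prod.snd (ht u))
  have e1 : ∀ x y : ℤ, projProd n (x, y) = projProd n (x + (2 * n : ℕ), y) := fun x y =>
    Prod.ext (by simp [projProd, proj_add]) rfl
  have e2 : ∀ x y : ℤ, projProd n (x, y) = projProd n (x, y + (2 * n : ℕ)) := fun x y =>
    Prod.ext rfl (by simp [projProd, proj_add])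
  obtain ⟨x, y, hxy⟩ := exists_square_of_winding (N := 2 * n)
    (c := fun x y => c (x, y)) (d := fun x y => d (x, y))
    (fun x y => hc _ _ 1 (e1 x y) (by push_cast; ring))
    (fun x y => by simpa using hc _ _ 0 (e2 x y) (by simp))
    (fun x y => by simpa using hd _ _ 0 (e1 x y) (by simp))
    (fun x y => hd _ _ 1 (e2 x y) (by push_cast; ring))
  -- Taking the odd member of each pair gives a corner to which the whole unit square specializes,
  -- so an open set containing it contains the square. In `U 0` the differences of `c` then vanish,
  -- in `U 1` those of `d`.
  obtain ⟨x', h1, h2⟩ : ∃ x', KLe x x' ∧ KLe (x + 1) x' :=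
    (KLe.succ x).elim (fun h => ⟨_, h, KLe.refl _⟩) fun h => ⟨_, KLe.refl _, h⟩
  obtain ⟨y', h3, h4⟩ : ∃ y', KLe y y' ∧ KLe (y + 1) y' :=
    (KLe.succ y).elim (fun h => ⟨_, h, KLe.refl _⟩) fun h => ⟨_, KLe.refl _, h⟩
  have hmem : ∀ i, projProd n (x', y') ∈ U i → ∀ v : ℤ × ℤ, KLe v.1 x' → KLe v.2 y' →
      projProd n v ∈ U i := fun i hi v hv hv' =>
    ((specializes_proj hv).prod (specializes_proj hv')).mem_open (hUo i) hi
  obtain ⟨i, hi⟩ := Set.mem_iUnion.1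
    (hU.symm ▸ Set.mem_univ (projProd n (x', y')) : projProd n (x', y') ∈ ⋃ i, U i)
  apply hxy
  fin_cases i
  · have key : ∀ v : ℤ × ℤ, KLe v.1 x' → KLe v.2 y' → c v = c (x', y') := fun v hv hv' =>
      hc' _ _ hv hv' (hmem 0 hi v hv hv') hi
    simp only [key (x, y) h1 h3, key (x + 1, y) h2 h3, key (x, y + 1) h1 h4]
    ring
  · have key : ∀ v : ℤ × ℤ, KLe v.1 x' → KLe v.2 y' → d v = d (x', y') := fun v hv hv' =>
      hd' _ _ hv hv' (hmem 1 hi v hv hv') hi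
    simp only [key (x + 1, y) h2 h3, key (x, y + 1) h1 h4, key (x + 1, y + 1) h2 h4]
    ring

end KhalimskyCircle

theorem mainTheorem3 :
    (∃ (X : Type) (_ : TopologicalSpace X), Finite X ∧ Nonempty X ∧ T0Space X ∧
      ∀ p : X × X, tc X < lsCat (X × X) p) ∧
    (∀ n : ℕ, 5 ≤ n →
      tc (KhalimskyCircle n) = 1 ∧
      ∀ p : KhalimskyCircle n × KhalimskyCircle n,
        lsCat (KhalimskyCircle n × KhalimskyCircle n) p = 2) := by
  have main : ∀ n : ℕ, 5 ≤ n → tc (KhalimskyCircle n) = 1 ∧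
      ∀ p : KhalimskyCircle n × KhalimskyCircle n,
        lsCat (KhalimskyCircle n × KhalimskyCircle n) p = 2 := fun n hn =>
    ⟨le_antisymm (KhalimskyCircle.tc_le_one hn) (KhalimskyCircle.one_le_tc (by omega)), fun p =>
      le_antisymm (KhalimskyCircle.lsCat_le_two (by omega) p)
        (KhalimskyCircle.two_le_lsCat (by omega) p)⟩
  refine ⟨⟨KhalimskyCircle 5, inferInstance, inferInstance, inferInstance,
    KhalimskyCircle.t0Space (by norm_num), fun p => ?_⟩, main⟩
  obtain ⟨h1, h2⟩ := main 5 le_rfl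
  rw [h1, h2 p]
  norm_num
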